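/- Let $d\ge 1$, $s\in(0,1)$ and $R>0$. There is a constant $C>0$, depending only on $d$, $s$ and $R$, such that the following holds. Let $\Omega\subset(-R,R)^d$ be open, and let $\mathcal T_h$ be a conforming simplicial mesh (finitely many, at least one, non-degenerate $d$-simplices, any two of which meet in a common face or not at all) contained in $[-R,R]^d$, with vertices $x_1,\dots,x_{N_v}$ and piecewise linear Lagrange basis functions $\phi_1,\dots,\phi_{N_v}$, extended by zero outside the mesh. Let $h$ be the maximum element diameter, $a_h$ the minimum height (distance from a vertex to the hyperplane through the opposite facet) over all elements, and $N_{val}$ the maximum over all vertices of the number of elements having that vertex. Let $N\ge 1$, let $h_{FD}=R/N$, let $x^{FD}_k=h_{FD}\,k$, $k\in\{-N,\dots,N\}^d$, be the nodes of the overlaying uniform grid, and let $N_{FD}^h$ be the maximum over all elements of the number of grid nodes in the closed element. Put $$(A_{FD})_{k,m}=\frac1{(2\pi)^d}\int_{[-\pi,\pi]^d}\Big(\sum_{i=1}^d 4\sin^2\frac{\xi_i}{2}\Big)^{s}e^{\mathrm i(k-m)\cdot\xi}\,d\xi,\qquad (I_h^{FD})_{k,j}=\phi_j(x^{FD}_k),$$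 and let $D_h$ be the diagonal matrix of the column sums of $I_h^{FD}$. Assume that $$h_{FD}\le\frac{a_h}{(d+1)\sqrt d}.$$ Let $u^e$ be an exact solution of $(-\Delta)^s u=f$ in $\Omega$, $u=0$ in $\mathbb R^d\setminus\Omega$ (that is, $u^e\in L^1(\mathbb R^d)$ vanishes outside $\Omega$, $f$ is locally integrable on $\Omega$, and the equation holds in the sense of distributions, $(-\Delta)^s$ being the Fourier multiplier $|\xi|^{2s}$). Let $\vec f_{FD}$ be the vector of the values of $f$ at the grid nodes, set to zero at the nodes outside $\Omega$, and $\vec u_h^{\,e}$ the vector of the values of $u^e$ at the mesh vertices, zero at the vertices outside $\Omega$. Let $\vec u_h\in\mathbb R^{N_v}$ be a solution of the GoFD scheme $$h_{FD}^{-2s}D_h^{-1}(I_h^{FD})^TA_{FD}I_h^{FD}\,\vec u_h=D_h^{-1}(I_h^{FD})^T\vec f_{FD},$$ either of the full system of $N_v$ equations, or of the equations belonging to the vertices in $\Omega$ with $\vec u_h$ set to zero at the vertices outside $\Omega$. Then the error $\vec e_h=\vec u_h-\vec u_h^{\,e}$ satisfies $$\vec e_h^{\,T}\vec e_h\le C\,N_{val}\,N_{FD}^h\Big(\frac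 h{a_h}\Big)^{4d}\,\vec\tau_{FD}^{\,T}\vec\tau_{FD},\qquad \vec\tau_{FD}=\vec f_{FD}-h_{FD}^{-2s}A_{FD}I_h^{FD}\vec u_h^{\,e}.$$ -/

import Mathlib

open scoped Matrix

noncomputable section

namespace GoFD

/-- The Euclidean space `ℝ^d`. -/
abbrev E (d : ℕ) := EuclideanSpace ℝ (Fin d)

/-! ### The continuous problem -/

/-- The fractional Laplacian through the Fourier transform, applied to a test function `φ`:
`(-Δ)^s φ (x) = (2π)^{-d} ∫ |ξ|^{2s} φ̂(ξ) e^{i x·ξ} dξ` with `φ̂(ξ) = ∫ φ(y) e^{-i y·ξ} dy`. -/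
def fracLaplacian {d : ℕ} (s : ℝ) (φ : E d → ℝ) (x : E d) : ℂ :=
  (1 / (2 * Real.pi : ℂ) ^ d) *
    ∫ ξ : E d, ((‖ξ‖ ^ (2 * s) : ℝ) : ℂ) *
      (∫ y : E d, (φ y : ℂ) * Complex.exp (-Complex.I * ((inner ℝ y ξ : ℝ) : ℂ))) *
        Complex.exp (Complex.I * ((inner ℝ x ξ : ℝ) : ℂ))

/-- `u` solves the homogeneous Dirichlet problem `(-Δ)^s u = f` in `Ω`, `u = 0` in `Ω^c`; the
equation in `Ω` is understood in the sense of distributions, so that classical solutions and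
finite-energy weak solutions are included. -/
structure IsExactSolution {d : ℕ} (s : ℝ) (Ω : Set (E d)) (f u : E d → ℝ) : Prop where
  integrable : MeasureTheory.Integrable u
  locallyIntegrable : MeasureTheory.LocallyIntegrableOn f Ω
  eq_zero : ∀ x, x ∉ Ω → u x = 0
  equation : ∀ φ : E d → ℝ, ContDiff ℝ (⊤ : ℕ∞) φ → HasCompactSupport φ → tsupport φ ⊆ Ω →
    ∫ x, (u x : ℂ) * fracLaplacian s φ x = ((∫ x in Ω, f x * φ x : ℝ) : ℂ)

/-! ### The uniform grid and the finite difference matrix -/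

/-- The open cube `(-R, R)^d`. -/
def openCube (d : ℕ) (R : ℝ) : Set (E d) := {x | ∀ i, -R < x i ∧ x i < R}

/-- The closed cube `[-R, R]^d`. -/
def closedCube (d : ℕ) (R : ℝ) : Set (E d) := {x | ∀ i, -R ≤ x i ∧ x i ≤ R}

/-- The spacing `h_FD = R / N` of the uniform grid. -/
def spacing (R : ℝ) (N : ℕ) : ℝ := R / N

/-- The multi-indices `{-N, …, N}^d` of the `(2N+1)^d` grid nodes. -/
abbrev GridIndex (d N : ℕ) := Fin d → ↥(Finset.Icc (-(N : ℤ)) (N : ℤ))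

/-- The grid node with multi-index `k`, that is, the point `h_FD k`. -/
def gridPoint {d : ℕ} (R : ℝ) (N : ℕ) (k : GridIndex d N) : E d :=
  WithLp.toLp 2 fun i => ((k i : ℤ) : ℝ) * spacing R N

/-- The symbol `ψ(ξ) = (∑ᵢ 4 sin²(ξᵢ/2))^s`. -/
def symbol {d : ℕ} (s : ℝ) (ξ : Fin d → ℝ) : ℝ :=
  (∑ i, 4 * Real.sin (ξ i / 2) ^ 2) ^ s

/-- The Fourier coefficients `(2π)^{-d} ∫_{[-π,π]^d} ψ(ξ) e^{i p·ξ} dξ` of the symbol. -/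
def complexCoeff {d : ℕ} (s : ℝ) (p : Fin d → ℤ) : ℂ :=
  (1 / (2 * Real.pi : ℂ) ^ d) *
    ∫ ξ in Set.Icc (fun _ : Fin d => -Real.pi) (fun _ => Real.pi),
      (symbol s ξ : ℂ) * Complex.exp (Complex.I * ((∑ i, (p i : ℝ) * ξ i : ℝ) : ℂ))

/-- The number `T_p`: the coefficient above, which is real (see `ofReal_coeff`). -/
def coeff {d : ℕ} (s : ℝ) (p : Fin d → ℤ) : ℝ := (complexCoeff s p).re

theorem ofReal_coeff {d : ℕ} (s : ℝ) (p : Fin d → ℤ) :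
    (coeff s p : ℂ) = complexCoeff s p := by
  refine Complex.conj_eq_iff_re.mp ?_
  unfold complexCoeff
  rw [map_mul, ← integral_conj]
  congr 1
  · simp [Complex.conj_ofNat]
  · have hpre : Neg.neg ⁻¹' Set.Icc (fun _ : Fin d => -Real.pi) (fun _ => Real.pi)
        = Set.Icc (fun _ : Fin d => -Real.pi) (fun _ => Real.pi) := by
      ext ξ
      simp only [Set.mem_preimage, Set.mem_Icc, Pi.le_def, Pi.neg_apply]
      constructor
      · rintro ⟨h1, h2⟩
        exact ⟨fun i => by linarith [h2 i], fun i => by linarith [h1 i]⟩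
      · rintro ⟨h1, h2⟩
        exact ⟨fun i => by linarith [h2 i], fun i => by linarith [h1 i]⟩
    have key := (MeasureTheory.Measure.measurePreserving_neg
      (MeasureTheory.volume : MeasureTheory.Measure (Fin d → ℝ))).setIntegral_preimage_emb
      (MeasurableEquiv.neg (Fin d → ℝ)).measurableEmbedding
      (fun ξ => (symbol s ξ : ℂ) * Complex.exp (Complex.I * ((∑ i, (p i : ℝ) * ξ i : ℝ) : ℂ)))
      (Set.Icc (fun _ : Fin d => -Real.pi) (fun _ => Real.pi))
    rw [hpre] at key
    rw [← key]
    congr 1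
    funext ξ
    have hs : symbol s (-ξ) = symbol s ξ := by
      simp [symbol, neg_div]
    rw [map_mul, Complex.conj_ofReal, ← Complex.exp_conj, map_mul, Complex.conj_I,
      Complex.conj_ofReal, hs]
    simp

/-- The matrix `A_FD`, with entries `T_{k - m}`. -/
def matrixFD (d N : ℕ) (s : ℝ) : Matrix (GridIndex d N) (GridIndex d N) ℝ :=
  Matrix.of fun k m => coeff s fun i => (k i : ℤ) - (m i : ℤ)

/-! ### Simplicial meshes and linear interpolation -/

/-- A (conforming) simplicial mesh in `ℝ^d`: a finite non-empty geometric simplicial complex in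
which every face is a face of a `d`-dimensional simplex. -/
structure SimplicialMesh (d : ℕ) extends Geometry.SimplicialComplex ℝ (E d) where
  finite_faces : faces.Finite
  nonempty_faces : faces.Nonempty
  pure : ∀ t ∈ faces, ∃ K ∈ faces, t ⊆ K ∧ K.card = d + 1

namespace SimplicialMesh

variable {d : ℕ} (M : SimplicialMesh d)

/-- The mesh elements, each given by its set of `d + 1` vertices. -/
def elements : Finset (Finset (E d)) :=
  (M.finite_faces.subset (Set.sep_subset M.faces fun K => K.card = d + 1)).toFinset

theorem mem_elements {K : Finset (E d)} : K ∈ M.elements ↔ K ∈ M.faces ∧ K.card = d + 1 := by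
  simp [elements]

theorem elements_nonempty : M.elements.Nonempty := by
  obtain ⟨t, ht⟩ := M.nonempty_faces
  obtain ⟨K, hK, -, hc⟩ := M.pure t ht
  exact ⟨K, M.mem_elements.2 ⟨hK, hc⟩⟩

open scoped Classical in
/-- The vertices of the mesh. -/
def nodes : Finset (E d) := M.elements.biUnion id

theorem mem_nodes {v : E d} : v ∈ M.nodes ↔ ∃ K ∈ M.elements, v ∈ K := by
  simp [nodes]

/-- The region covered by the mesh. -/
def region : Set (E d) := ⋃ K ∈ M.elements, convexHull ℝ (K : Set (E d))

/-- `w` lists the barycentric coordinates of `x` in an element that contains `x`, extended by zero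
to the vertices outside that element. -/
def IsBarycentric (w : E d → ℝ) (x : E d) : Prop :=
  ∃ K ∈ M.elements, (∀ v, 0 ≤ w v) ∧ (∀ v, v ∉ K → w v = 0) ∧
    ∑ v ∈ K, w v = 1 ∧ ∑ v ∈ K, w v • v = x

open scoped Classical in
/-- The Lagrange-type piecewise linear basis function `φ_v` of the vertex `v`: on an element `K` it
is the barycentric coordinate associated with `v` (zero if `v` is not a vertex of `K`), and it
vanishes outside the mesh. -/
def hat (v x : E d) : ℝ :=
  if h : ∃ w, M.IsBarycentric w x then h.choose v else 0

theorem isBarycentric_unique {w w' : E d → ℝ} {x : E d} (h : M.IsBarycentric w x)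
    (h' : M.IsBarycentric w' x) : w = w' := by
  classical
  have aux : ∀ K ∈ M.elements, ∀ w : E d → ℝ, (∀ v, 0 ≤ w v) → ∑ v ∈ K, w v = 1 →
      ∑ v ∈ K, w v • v = x → x ∈ convexHull ℝ (K : Set (E d)) := by
    intro K _ w h0 h1 hx
    rw [Finset.mem_convexHull']
    exact ⟨w, fun v _ => h0 v, h1, hx⟩
  obtain ⟨K, hK, h0, hz, h1, hx⟩ := h
  obtain ⟨K', hK', h0', hz', h1', hx'⟩ := h'
  have hint := M.inter_subset_convexHull (M.mem_elements.1 hK).1 (M.mem_elements.1 hK').1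
    ⟨aux K hK w h0 h1 hx, aux K' hK' w' h0' h1' hx'⟩
  rw [← Finset.coe_inter, Finset.mem_convexHull'] at hint
  obtain ⟨g, -, hg1, hgx⟩ := hint
  have uniq : ∀ L ∈ M.elements, K ∩ K' ⊆ L → ∀ w : E d → ℝ, (∀ v, v ∉ L → w v = 0) →
      ∑ v ∈ L, w v = 1 → ∑ v ∈ L, w v • v = x →
      ∀ v, w v = if v ∈ K ∩ K' then g v else 0 := by
    intro L hL hsub w hz h1 hx v
    by_cases hv : v ∈ L
    · have hind := M.indep (M.mem_elements.1 hL).1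
      rw [affineIndependent_iff] at hind
      have e1 : ∑ v ∈ L, (if v ∈ K ∩ K' then g v else 0) = 1 := by
        rw [Finset.sum_ite_mem, Finset.inter_eq_right.2 hsub, hg1]
      have e2 : ∑ v ∈ L, (if v ∈ K ∩ K' then g v else 0) • v = x := by
        simp only [ite_smul, zero_smul]
        rw [Finset.sum_ite_mem, Finset.inter_eq_right.2 hsub, hgx]
      have := hind Finset.univ (fun y : L => w y - if (y : E d) ∈ K ∩ K' then g y else 0)
        (by
          rw [Finset.sum_coe_sort L (fun y => w y - if y ∈ K ∩ K' then g y else 0),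
            Finset.sum_sub_distrib, h1, e1, sub_self])
        (by
          rw [Finset.sum_coe_sort L (fun y => (w y - if y ∈ K ∩ K' then g y else 0) • y)]
          simp only [sub_smul]
          rw [Finset.sum_sub_distrib, hx, e2, sub_self])
        ⟨v, hv⟩ (Finset.mem_univ _)
      exact sub_eq_zero.1 this
    · rw [hz v hv, if_neg fun h => hv (hsub h)]
  funext v
  rw [uniq K hK Finset.inter_subset_left w hz h1 hx v,
    uniq K' hK' Finset.inter_subset_right w' hz' h1' hx' v]

/-- The basis function does not depend on the element used to evaluate it. -/
theorem hat_eq {w : E d → ℝ} {x : E d} (h : M.IsBarycentric w x) (v : E d) : M.hat v x = w v := by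
  have hex : ∃ w, M.IsBarycentric w x := ⟨w, h⟩
  rw [hat, dif_pos hex, M.isBarycentric_unique hex.choose_spec h]

/-- The height of the simplex with vertex set `K` over the facet opposite to its vertex `v`: the
distance from `v` to the hyperplane through the other vertices. -/
def height (K : Finset (E d)) (v : E d) : ℝ :=
  Metric.infDist v (affineSpan ℝ ((K : Set (E d)) \ {v}) : Set (E d))

/-- The minimum height `a_K` of an element (the value for the empty set is irrelevant). -/
def minHeightOf (K : Finset (E d)) : ℝ := ⨅ v : K, height K v

/-- The minimum element height `a_h` of the mesh. -/
def minHeight : ℝ := M.elements.inf' M.elements_nonempty minHeightOf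

/-- The maximum element diameter `h` of the mesh. -/
def maxDiam : ℝ :=
  M.elements.sup' M.elements_nonempty fun K => Metric.diam (convexHull ℝ (K : Set (E d)))

open scoped Classical in
/-- The valence `N_val`: the maximum over the vertices of the number of elements that have the
vertex as one of their vertices. -/
def valence : ℕ := M.nodes.sup fun v => (M.elements.filter fun K => v ∈ K).card

open scoped Classical in
/-- `N_FD^h`: the maximum over the elements of the number of grid nodes in the closed element. -/
def maxGridNodes (R : ℝ) (N : ℕ) : ℕ :=
  M.elements.sup fun K =>
    (Finset.univ.filter fun k : GridIndex d N =>
      gridPoint R N k ∈ convexHull ℝ (K : Set (E d))).card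

/-! ### The scheme -/

/-- The transfer matrix `I_h^FD`, with entries `φ_j(x_k^FD)`. -/
def transfer (R : ℝ) (N : ℕ) : Matrix (GridIndex d N) M.nodes ℝ :=
  Matrix.of fun k j => M.hat j (gridPoint R N k)

open scoped Classical in
/-- The diagonal matrix `D_h` of the column sums of the transfer matrix. -/
def columnSums (R : ℝ) (N : ℕ) : Matrix M.nodes M.nodes ℝ :=
  Matrix.diagonal fun j => ∑ k, M.transfer R N k j

open scoped Classical in
/-- The matrix `A_h = D_h⁻¹ (I_h^FD)ᵀ A_FD I_h^FD`. -/
def stiffness (s R : ℝ) (N : ℕ) : Matrix M.nodes M.nodes ℝ :=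
  (M.columnSums R N)⁻¹ * (M.transfer R N)ᵀ * matrixFD d N s * M.transfer R N

end SimplicialMesh

open scoped Classical in
/-- The values of `f` at the grid nodes, replaced by zero at the nodes outside `Ω`. -/
def gridValues {d : ℕ} (Ω : Set (E d)) (f : E d → ℝ) (R : ℝ) (N : ℕ) (k : GridIndex d N) : ℝ :=
  if gridPoint R N k ∈ Ω then f (gridPoint R N k) else 0

open scoped Classical in
/-- The values of `u` at the mesh vertices, replaced by zero at the vertices outside `Ω`. -/
def nodalValues {d : ℕ} (M : SimplicialMesh d) (Ω : Set (E d)) (u : E d → ℝ) (j : M.nodes) : ℝ :=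
  if (j : E d) ∈ Ω then u j else 0

/-- The left-hand side `h_FD^{-2s} A_h u_h` of the scheme. -/
def schemeLHS {d : ℕ} (M : SimplicialMesh d) (s R : ℝ) (N : ℕ) (uh : M.nodes → ℝ) : M.nodes → ℝ :=
  (1 / spacing R N ^ (2 * s)) • (M.stiffness s R N *ᵥ uh)

open scoped Classical in
/-- The right-hand side `D_h⁻¹ (I_h^FD)ᵀ f_FD` of the scheme. -/
def schemeRHS {d : ℕ} (M : SimplicialMesh d) (Ω : Set (E d)) (f : E d → ℝ) (R : ℝ) (N : ℕ) :
    M.nodes → ℝ :=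
  ((M.columnSums R N)⁻¹ * (M.transfer R N)ᵀ) *ᵥ gridValues Ω f R N

/-- `uh` satisfies all `N_v` equations of the scheme. -/
def SolvesFullScheme {d : ℕ} (M : SimplicialMesh d) (Ω : Set (E d)) (s R : ℝ) (N : ℕ)
    (f : E d → ℝ) (uh : M.nodes → ℝ) : Prop :=
  schemeLHS M s R N uh = schemeRHS M Ω f R N

/-- `uh` vanishes at the vertices outside `Ω` and satisfies the equations of the scheme that belong
to the vertices in `Ω`. -/
def SolvesInteriorScheme {d : ℕ} (M : SimplicialMesh d) (Ω : Set (E d)) (s R : ℝ) (N : ℕ)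
    (f : E d → ℝ) (uh : M.nodes → ℝ) : Prop :=
  (∀ j : M.nodes, (j : E d) ∉ Ω → uh j = 0) ∧
    ∀ j : M.nodes, (j : E d) ∈ Ω → schemeLHS M s R N uh j = schemeRHS M Ω f R N j

/-- The local truncation error `τ_FD = f_FD - h_FD^{-2s} A_FD I_h^FD u_h^e`. -/
def truncationError {d : ℕ} (M : SimplicialMesh d) (Ω : Set (E d)) (s R : ℝ) (N : ℕ)
    (f ue : E d → ℝ) : GridIndex d N → ℝ :=
  gridValues Ω f R N -
    (1 / spacing R N ^ (2 * s)) • (matrixFD d N s *ᵥ (M.transfer R N *ᵥ nodalValues M Ω ue))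

end GoFD

end

noncomputable section

namespace GoFD

/-! ### Coercivity of the finite difference matrix -/

/-! Write `e` for the nodal error, `w` for its transfer to the grid and `τ` for the truncation
error. Multiplying the scheme by `D_h` and testing it with `e` gives the energy identity `h_FD^{-2s}
w·A_FD w = w·τ` (`energy_eq_truncationError`). Two lower bounds turn it into the estimate.

Coercivity (`matrixFD_coercive`): `w·A_FD w` is the integral of the symbol against the squared
modulus of a trigonometric polynomial with coefficients `w`. The symbol is small only near the
origin, and a polynomial with `(2N+1)^d` frequencies cannot concentrate more than half of its mass
in a box of side about `1/N`. Hence `A_FD` is bounded below by a multiple of `N^{-2s}`; the scaling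
by `h_FD^{-2s}` cancels `N` and leaves `κ |w| ≤ |τ|` with `κ` depending on `R` and `s` only.

Stability (`dotProduct_le_transfer`): the spacing condition places in each element a grid point and
its neighbours, several steps away, in all coordinate directions. An affine function is determined
by these values, so nodal values are controlled by `w` on the element, with a factor of order
`h/a_h`. Summing over elements costs `(d+1) N_val`.

The result has the exponent 2 and no factor `N_FD^h`; the stated form follows from `h/a_h ≥ 1` and
`N_FD^h ≥ 1`. -/

/-- The period box `[-π, π]^d`. -/
def periodBox (d : ℕ) : Set (Fin d → ℝ) :=
  Set.Icc (fun _ : Fin d => -Real.pi) (fun _ => Real.pi)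

theorem integral_exp_int_mul {p : ℤ} (hp : p ≠ 0) :
    ∫ x in Set.Icc (-Real.pi) Real.pi, Complex.exp (Complex.I * ((p : ℝ) * x : ℝ)) = 0 := by
  rw [MeasureTheory.integral_Icc_eq_integral_Ioc,
    ← intervalIntegral.integral_of_le (by linarith [Real.pi_pos])]
  have hc : Complex.I * (p : ℂ) ≠ 0 := mul_ne_zero Complex.I_ne_zero (by exact_mod_cast hp)
  have : ∀ x : ℝ, Complex.exp (Complex.I * ((p : ℝ) * x : ℝ))
      = Complex.exp (Complex.I * (p : ℂ) * x) := by
    intro x; push_cast; ring_nf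
  simp_rw [this]
  rw [integral_exp_mul_complex hc, div_eq_zero_iff]
  left
  rw [sub_eq_zero, Complex.exp_eq_exp_iff_exists_int]
  refine ⟨p, ?_⟩
  push_cast
  ring

theorem integral_periodBox_exp {d : ℕ} (p : Fin d → ℤ) :
    ∫ ξ in periodBox d, Complex.exp (Complex.I * ((∑ i, (p i : ℝ) * ξ i : ℝ) : ℂ))
      = if p = 0 then (2 * Real.pi : ℂ) ^ d else 0 := by
  have h1 : ∀ ξ : Fin d → ℝ, Complex.exp (Complex.I * ((∑ i, (p i : ℝ) * ξ i : ℝ) : ℂ))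
      = ∏ i, Complex.exp (Complex.I * (((p i : ℝ) * ξ i : ℝ) : ℂ)) := by
    intro ξ
    rw [← Complex.exp_sum, Complex.ofReal_sum, Finset.mul_sum]
  simp_rw [h1]
  rw [periodBox, ← Set.pi_univ_Icc, MeasureTheory.volume_pi, MeasureTheory.Measure.restrict_pi_pi,
    MeasureTheory.integral_fintype_prod_eq_prod
      (f := fun i (x : ℝ) => Complex.exp (Complex.I * (((p i : ℝ) * x : ℝ) : ℂ)))]
  split_ifs with hp
  · subst hp
    have : (0 : ℝ) ≤ Real.pi + Real.pi := by linarith [Real.pi_pos]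
    simp [this, two_mul]
  · obtain ⟨i, hi⟩ := Function.ne_iff.1 hp
    exact Finset.prod_eq_zero (Finset.mem_univ i) (integral_exp_int_mul hi)

section TrigonometricPolynomial

variable {d : ℕ} {ι : Type*} [Fintype ι] (p : ι → Fin d → ℤ) (v : ι → ℝ)

/-- The trigonometric polynomial with frequencies `p` and coefficients `v`. -/
def trigPoly (ξ : Fin d → ℝ) : ℂ :=
  ∑ k, (v k : ℂ) * Complex.exp (Complex.I * ((∑ i, (p k i : ℝ) * ξ i : ℝ) : ℂ))

theorem continuous_trigPoly : Continuous (trigPoly p v) := by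
  unfold trigPoly
  fun_prop

/-- Cauchy–Schwarz on the coefficients. This sup bound is what prevents concentration of mass near
the origin. -/
theorem normSq_trigPoly_le (ξ : Fin d → ℝ) :
    ‖trigPoly p v ξ‖ ^ 2 ≤ Fintype.card ι * ∑ k, v k ^ 2 := by
  have h1 : ‖trigPoly p v ξ‖ ≤ ∑ k, |v k| := by
    refine (norm_sum_le _ _).trans_eq (Finset.sum_congr rfl fun k _ => ?_)
    rw [norm_mul, mul_comm Complex.I, Complex.norm_exp_ofReal_mul_I, mul_one, Complex.norm_real,
      Real.norm_eq_abs]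
  calc ‖trigPoly p v ξ‖ ^ 2 ≤ (∑ k, |v k|) ^ 2 := by gcongr
    _ ≤ Fintype.card ι * ∑ k, |v k| ^ 2 := by
        simpa using sq_sum_le_card_mul_sum_sq (s := Finset.univ) (f := fun k => |v k|)
    _ = _ := by simp

theorem ofReal_normSq_trigPoly (ξ : Fin d → ℝ) :
    ((‖trigPoly p v ξ‖ ^ 2 : ℝ) : ℂ) = ∑ k, ∑ m, (v k * v m : ℂ) *
      Complex.exp (Complex.I * ((∑ i, ((p k i - p m i : ℤ) : ℝ) * ξ i : ℝ) : ℂ)) := by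
  rw [Complex.ofReal_pow, ← Complex.mul_conj', trigPoly, map_sum, Finset.sum_mul_sum]
  refine Finset.sum_congr rfl fun k _ => Finset.sum_congr rfl fun m _ => ?_
  rw [map_mul, Complex.conj_ofReal, ← Complex.exp_conj, map_mul, Complex.conj_I,
    Complex.conj_ofReal, mul_mul_mul_comm, ← Complex.exp_add]
  congr 2
  push_cast
  simp only [sub_mul, Finset.sum_sub_distrib]
  ring

/-- Serves twice: the weight `1` yields Parseval's identity, the weight `symbol s` the quadratic
form of `A_FD`. -/
theorem ofReal_integral_mul_normSq_trigPoly {g : (Fin d → ℝ) → ℝ} (hg : Continuous g) :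
    ((∫ ξ in periodBox d, g ξ * ‖trigPoly p v ξ‖ ^ 2 : ℝ) : ℂ) =
      ∑ k, ∑ m, (v k * v m : ℂ) * ∫ ξ in periodBox d, (g ξ : ℂ) *
        Complex.exp (Complex.I * ((∑ i, ((p k i - p m i : ℤ) : ℝ) * ξ i : ℝ) : ℂ)) := by
  rw [← integral_complex_ofReal]
  have h1 : ∀ ξ, ((g ξ * ‖trigPoly p v ξ‖ ^ 2 : ℝ) : ℂ) = ∑ k, ∑ m, (v k * v m : ℂ) * ((g ξ : ℂ) *
        Complex.exp (Complex.I * ((∑ i, ((p k i - p m i : ℤ) : ℝ) * ξ i : ℝ) : ℂ))) := by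
    intro ξ
    rw [Complex.ofReal_mul, ofReal_normSq_trigPoly, Finset.mul_sum]
    refine Finset.sum_congr rfl fun k _ => ?_
    rw [Finset.mul_sum]
    exact Finset.sum_congr rfl fun m _ => by ring
  have hint : ∀ k m, MeasureTheory.IntegrableOn (fun ξ : Fin d → ℝ => (v k * v m : ℂ) * ((g ξ : ℂ) *
        Complex.exp (Complex.I * ((∑ i, ((p k i - p m i : ℤ) : ℝ) * ξ i : ℝ) : ℂ))))
        (periodBox d) := fun k m =>
    Continuous.integrableOn_Icc (by fun_prop)
  simp_rw [h1]
  rw [MeasureTheory.integral_finsetSum _ fun k _ =>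
    MeasureTheory.integrable_finsetSum _ fun m _ => hint k m]
  refine Finset.sum_congr rfl fun k _ => ?_
  rw [MeasureTheory.integral_finsetSum _ fun m _ => hint k m]
  exact Finset.sum_congr rfl fun m _ => MeasureTheory.integral_const_mul _ _

/-- Parseval's identity. -/
theorem integral_normSq_trigPoly (hp : Function.Injective p) :
    ∫ ξ in periodBox d, ‖trigPoly p v ξ‖ ^ 2 = (2 * Real.pi) ^ d * ∑ k, v k ^ 2 := by
  classical
  have h := ofReal_integral_mul_normSq_trigPoly p v (g := fun _ => 1) continuous_const
  simp only [one_mul, Complex.ofReal_one] at h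
  rw [← Complex.ofReal_inj, h]
  simp only [fun k m => integral_periodBox_exp fun i => p k i - p m i]
  have : ∀ k m, (fun i => p k i - p m i) = 0 ↔ k = m := fun k m => by
    rw [← hp.eq_iff, ← sub_eq_zero (a := p k)]; rfl
  simp only [this, mul_ite, mul_zero, Finset.sum_ite_eq, Finset.mem_univ, if_true]
  push_cast
  rw [Finset.mul_sum]
  exact Finset.sum_congr rfl fun k _ => by ring

end TrigonometricPolynomial

/-! ### Lower bounds for the symbol and the quadratic form -/

theorem symbol_nonneg {d : ℕ} (s : ℝ) (ξ : Fin d → ℝ) : 0 ≤ symbol s ξ :=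
  Real.rpow_nonneg (Finset.sum_nonneg fun i _ => by positivity) _

theorem continuous_symbol {d : ℕ} {s : ℝ} (hs : 0 ≤ s) :
    Continuous (symbol s : (Fin d → ℝ) → ℝ) := by
  unfold symbol
  exact Continuous.rpow_const (by fun_prop) fun _ => Or.inr hs

/-- Jordan's inequality `sin y ≥ 2y/π` on `[0, π/2]`, at `y = |x|/2`. -/
theorem sq_le_four_mul_sin_sq {x δ : ℝ} (hδ : 0 ≤ δ) (hx : |x| ≤ Real.pi)
    (h : Real.pi * δ / 2 ≤ |x|) : δ ^ 2 ≤ 4 * Real.sin (x / 2) ^ 2 := by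
  have h1 : 2 / Real.pi * (|x| / 2) ≤ Real.sin (|x| / 2) :=
    Real.mul_le_sin (by positivity) (by linarith)
  have h2 : Real.sin (x / 2) ^ 2 = Real.sin (|x| / 2) ^ 2 := by
    rcases abs_cases x with ⟨h, -⟩ | ⟨h, -⟩ <;> rw [h]
    rw [neg_div, Real.sin_neg, neg_sq]
  have h3 : δ / 2 ≤ 2 / Real.pi * (|x| / 2) := by
    rw [div_mul_div_comm, le_div_iff₀ (by positivity)]
    linarith
  rw [h2]
  nlinarith [h3.trans h1]

theorem rpow_le_symbol {d : ℕ} {s δ : ℝ} (hs : 0 ≤ s) (hδ : 0 ≤ δ) {ξ : Fin d → ℝ}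
    (hξ : ξ ∈ periodBox d)
    (h : ξ ∉ Set.Icc (fun _ : Fin d => -(Real.pi * δ / 2)) (fun _ => Real.pi * δ / 2)) :
    δ ^ (2 * s) ≤ symbol s ξ := by
  obtain ⟨i, hi⟩ : ∃ i, Real.pi * δ / 2 ≤ |ξ i| := by
    by_contra! hc
    exact h ⟨fun i => (abs_le.1 (hc i).le).1, fun i => (abs_le.1 (hc i).le).2⟩
  have h1 := sq_le_four_mul_sin_sq hδ (abs_le.2 ⟨hξ.1 i, hξ.2 i⟩) hi
  rw [symbol, Real.rpow_mul hδ, Real.rpow_two]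
  refine Real.rpow_le_rpow (by positivity) (h1.trans ?_) hs
  exact Finset.single_le_sum (f := fun i => 4 * Real.sin (ξ i / 2) ^ 2)
    (fun j _ => by positivity) (Finset.mem_univ i)

/-- The sup bound of the polynomial is subtracted on the small box `B` of side `πδ`. There the
difference is nonpositive, hence harmless; off `B` the symbol is at least `δ^{2s}`. Parseval and the
volume of `B` evaluate what remains. -/
theorem le_integral_symbol_mul_normSq_trigPoly {d : ℕ} {ι : Type*} [Fintype ι]
    {p : ι → Fin d → ℤ} (hp : Function.Injective p) (v : ι → ℝ) {s δ : ℝ} (hs : 0 ≤ s)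
    (hδ : 0 ≤ δ) :
    δ ^ (2 * s) * ((2 * Real.pi) ^ d - (Real.pi * δ) ^ d * Fintype.card ι) * ∑ k, v k ^ 2
      ≤ ∫ ξ in periodBox d, symbol s ξ * ‖trigPoly p v ξ‖ ^ 2 := by
  set B : Set (Fin d → ℝ) :=
    Set.Icc (fun _ : Fin d => -(Real.pi * δ / 2)) (fun _ => Real.pi * δ / 2) with hB
  set S := ∑ k, v k ^ 2 with hS
  have hS0 : 0 ≤ S := Finset.sum_nonneg fun k _ => sq_nonneg _
  have hBm : MeasurableSet B := measurableSet_Icc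
  have hcont : Continuous fun ξ => ‖trigPoly p v ξ‖ ^ 2 := (continuous_trigPoly p v).norm.pow 2
  have hvol : (MeasureTheory.volume B).toReal = (Real.pi * δ) ^ d := by
    rw [hB, Real.volume_Icc_pi_toReal (fun _ => by
      have : 0 ≤ Real.pi * δ / 2 := by positivity
      linarith)]
    simp
  have hfin : MeasureTheory.volume B ≠ ⊤ := isCompact_Icc.measure_ne_top
  have hbox : MeasureTheory.IntegrableOn (B.indicator fun _ => Fintype.card ι * S)
      (periodBox d) :=
    ((MeasureTheory.integrableOn_const hfin).integrable_indicator hBm).integrableOn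
  have hind : ∫ ξ in periodBox d, B.indicator (fun _ => Fintype.card ι * S) ξ
      ≤ (Real.pi * δ) ^ d * (Fintype.card ι * S) := by
    refine (MeasureTheory.setIntegral_le_integral
      ((MeasureTheory.integrableOn_const hfin).integrable_indicator hBm)
      (Filter.Eventually.of_forall fun ξ =>
        Set.indicator_nonneg (fun _ _ => by positivity) ξ)).trans_eq ?_
    rw [MeasureTheory.integral_indicator hBm, MeasureTheory.setIntegral_const, smul_eq_mul,
      MeasureTheory.measureReal_def, hvol]
  calc δ ^ (2 * s) * ((2 * Real.pi) ^ d - (Real.pi * δ) ^ d * Fintype.card ι) * S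
      = δ ^ (2 * s) * ((2 * Real.pi) ^ d * S - (Real.pi * δ) ^ d * (Fintype.card ι * S)) := by ring
    _ ≤ δ ^ (2 * s) * ∫ ξ in periodBox d, (‖trigPoly p v ξ‖ ^ 2
          - B.indicator (fun _ => Fintype.card ι * S) ξ) := by
        rw [MeasureTheory.integral_sub (μ := MeasureTheory.volume.restrict (periodBox d))
          hcont.integrableOn_Icc hbox, integral_normSq_trigPoly p v hp]
        gcongr
    _ = ∫ ξ in periodBox d, δ ^ (2 * s) * (‖trigPoly p v ξ‖ ^ 2
          - B.indicator (fun _ => Fintype.card ι * S) ξ) :=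
        (MeasureTheory.integral_const_mul _ _).symm
    _ ≤ ∫ ξ in periodBox d, symbol s ξ * ‖trigPoly p v ξ‖ ^ 2 := by
        refine MeasureTheory.setIntegral_mono_on
          ((MeasureTheory.Integrable.sub hcont.integrableOn_Icc hbox).const_mul _)
          ((continuous_symbol hs).mul hcont).integrableOn_Icc measurableSet_Icc fun ξ hξ => ?_
        by_cases hξB : ξ ∈ B
        · rw [Set.indicator_of_mem hξB]
          refine (mul_nonpos_of_nonneg_of_nonpos (by positivity)
            (sub_nonpos.2 (normSq_trigPoly_le p v ξ))).trans ?_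
          exact mul_nonneg (symbol_nonneg s ξ) (by positivity)
        · rw [Set.indicator_of_notMem hξB, sub_zero]
          exact mul_le_mul_of_nonneg_right (rpow_le_symbol hs hδ hξ hξB) (by positivity)

theorem dotProduct_matrixFD_mulVec {d N : ℕ} {s : ℝ} (hs : 0 ≤ s) (v : GridIndex d N → ℝ) :
    v ⬝ᵥ (matrixFD d N s *ᵥ v) = 1 / (2 * Real.pi) ^ d *
      ∫ ξ in periodBox d, symbol s ξ *
        ‖trigPoly (fun (k : GridIndex d N) i => (k i : ℤ)) v ξ‖ ^ 2 := by
  rw [← Complex.ofReal_inj, Complex.ofReal_mul,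
    ofReal_integral_mul_normSq_trigPoly _ _ (continuous_symbol hs), Finset.mul_sum]
  rw [dotProduct, Complex.ofReal_sum]
  refine Finset.sum_congr rfl fun k _ => ?_
  rw [Matrix.mulVec, dotProduct, Finset.mul_sum, Finset.mul_sum, Complex.ofReal_sum]
  refine Finset.sum_congr rfl fun m _ => ?_
  rw [matrixFD, Matrix.of_apply, Complex.ofReal_mul, Complex.ofReal_mul, ofReal_coeff,
    complexCoeff, periodBox]
  have hc : ((1 / (2 * Real.pi) ^ d : ℝ) : ℂ) = 1 / (2 * Real.pi : ℂ) ^ d := by push_cast; rfl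
  rw [hc]
  ring

/-- The smallest eigenvalue of `A_FD` is bounded below by a multiple of `N^{-2s}`. -/
theorem matrixFD_coercive {d N : ℕ} (hd : 1 ≤ d) (hN : 1 ≤ N) {s : ℝ} (hs : 0 ≤ s)
    (v : GridIndex d N → ℝ) :
    (1 / (3 * N : ℝ)) ^ (2 * s) / 2 * (v ⬝ᵥ v) ≤ v ⬝ᵥ (matrixFD d N s *ᵥ v) := by
  have hN0 : (1 : ℝ) ≤ N := by exact_mod_cast hN
  have hp : Function.Injective fun (k : GridIndex d N) i => (k i : ℤ) := fun k m h =>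
    funext fun i => Subtype.ext (congrFun h i)
  -- Since `2N + 1 ≤ 3N`, this `δ` gives `πδ(2N+1) ≤ π`, so the small box accounts for at most half
  -- of `(2π)^d`; the half uses `2 ≤ 2^d`.
  have h := le_integral_symbol_mul_normSq_trigPoly hp v hs (δ := 1 / (3 * N : ℝ)) (by positivity)
  have hcard : (Fintype.card (GridIndex d N) : ℝ) = (2 * N + 1) ^ d := by
    have h1 : ((N : ℤ) + 1 - -(N : ℤ)).toNat = 2 * N + 1 := by omega
    rw [Fintype.card_fun, Fintype.card_coe, Int.card_Icc, Fintype.card_fin, h1]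
    push_cast
    rfl
  have h2 : (Real.pi * (1 / (3 * N : ℝ))) ^ d * Fintype.card (GridIndex d N)
      ≤ (2 * Real.pi) ^ d / 2 := by
    rw [hcard, ← mul_pow]
    have h3 : Real.pi * (1 / (3 * N : ℝ)) * (2 * N + 1) ≤ Real.pi := by
      rw [mul_assoc]
      refine mul_le_of_le_one_right Real.pi_pos.le ?_
      rw [one_div_mul_eq_div, div_le_one (by positivity)]
      linarith
    calc _ ≤ Real.pi ^ d := pow_le_pow_left₀ (by positivity) h3 d
      _ ≤ (2 * Real.pi) ^ d / 2 := by
          rw [mul_pow, le_div_iff₀ two_pos, mul_comm]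
          gcongr
          exact le_self_pow₀ one_le_two (by omega)
  have hvv : v ⬝ᵥ v = ∑ k, v k ^ 2 := by simp [dotProduct, sq]
  rw [dotProduct_matrixFD_mulVec hs, one_div_mul_eq_div, le_div_iff₀ (by positivity), hvv]
  refine le_trans ?_ h
  rw [mul_right_comm]
  refine mul_le_mul_of_nonneg_right ?_ (Finset.sum_nonneg fun k _ => sq_nonneg _)
  rw [div_mul_eq_mul_div, mul_div_assoc]
  refine mul_le_mul_of_nonneg_left (by linarith) (by positivity)

/-! ### Stability of the transfer matrix -/

theorem mem_affineSpan_of_coord_eq_zero {ι V : Type*} [Fintype ι]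
    [NormedAddCommGroup V] [NormedSpace ℝ V] (b : AffineBasis ι ℝ V) {i : ι} {z : V}
    (hz : b.coord i z = 0) : z ∈ affineSpan ℝ (b '' {i}ᶜ) := by
  rw [← b.affineCombination_coord_eq_self z]
  refine affineCombination_mem_affineSpan_image (b.sum_coord_apply_eq_one z) (fun j _ hj => ?_) _
  have : j = i := by simpa using hj
  rw [this, hz]

/-- The barycentric coordinate of a vertex varies by at most the distance divided by the height. -/
theorem abs_coord_sub_mul_infDist_le {ι V : Type*} [Fintype ι]
    [NormedAddCommGroup V] [NormedSpace ℝ V] (b : AffineBasis ι ℝ V) (i : ι) (x y : V) :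
    |b.coord i x - b.coord i y| * Metric.infDist (b i) (affineSpan ℝ (b '' {i}ᶜ) : Set V)
      ≤ ‖x - y‖ := by
  set t := b.coord i x - b.coord i y with ht
  rcases eq_or_ne t 0 with h0 | h0
  · simp [h0]
  have hlin : (b.coord i).linear (x - y) = t := by
    have := (b.coord i).linearMap_vsub x y
    simpa using this
  -- Moving from the vertex along `x - y`, scaled so that the coordinate drops from 1 to 0, reaches
  -- the opposite hyperplane; the length of this move bounds the height.
  have hz : b.coord i (b i - t⁻¹ • (x - y)) = 0 := by
    have := (b.coord i).map_vadd (b i) (-(t⁻¹ • (x - y)))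
    rw [vadd_eq_add, vadd_eq_add, map_neg, map_smul, hlin, b.coord_apply_eq, smul_eq_mul,
      inv_mul_cancel₀ h0, neg_add_cancel] at this
    rwa [neg_add_eq_sub] at this
  have hd := Metric.infDist_le_dist_of_mem (x := b i)
    (mem_affineSpan_of_coord_eq_zero b hz)
  rw [dist_eq_norm, sub_sub_cancel, norm_smul, norm_inv, Real.norm_eq_abs] at hd
  calc |t| * _ ≤ |t| * (|t|⁻¹ * ‖x - y‖) := by gcongr
    _ = ‖x - y‖ := mul_inv_cancel_left₀ (abs_ne_zero.2 h0) _

theorem sum_smul_affineMap_apply {ι V : Type*} [AddCommGroup V] [Module ℝ V] (s : Finset ι)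
    (c : ι → ℝ) (f : ι → V →ᵃ[ℝ] ℝ) (x : V) :
    (∑ i ∈ s, c i • f i) x = ∑ i ∈ s, c i * f i x := by
  classical
  induction s using Finset.induction_on with
  | empty => simp
  | insert i s hi ih => simp [Finset.sum_insert hi, ih]

theorem sum_biUnion_le {α : Type*} [DecidableEq α] {f : α → ℝ} (hf : ∀ a, 0 ≤ f a)
    (s : Finset (Finset α)) :
    ∑ a ∈ s.biUnion id, f a ≤ ∑ t ∈ s, ∑ a ∈ t, f a := by
  induction s using Finset.induction_on with
  | empty => simp
  | insert t s ht ih =>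
    rw [Finset.biUnion_insert, Finset.sum_insert ht]
    have h := Finset.sum_union_inter (s₁ := id t) (s₂ := s.biUnion id) (f := f)
    have h' : 0 ≤ ∑ a ∈ id t ∩ s.biUnion id, f a := Finset.sum_nonneg fun a _ => hf a
    simp only [id_eq] at h h' ⊢
    linarith

/-- An affine function is bounded in terms of its values at `z` and at `d` neighbours of `z` in the
coordinate directions. -/
theorem abs_affineMap_le {d : ℕ} (l : E d →ᵃ[ℝ] ℝ) {z : E d} {t B : ℝ} (ht : 0 < t)
    (h0 : |l z| ≤ B) (h1 : ∀ i, |l (z + t • EuclideanSpace.single i 1)| ≤ B) (y : E d) :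
    |l y| ≤ (1 + 2 * d * (‖y - z‖ / t)) * B := by
  have hB : 0 ≤ B := (abs_nonneg _).trans h0
  have hadd : ∀ w, l (z + w) = l z + l.linear w := fun w => by
    have := l.map_vadd z w
    rw [vadd_eq_add, vadd_eq_add] at this
    rw [add_comm z, this, add_comm]
  have hdir : ∀ i, |l.linear (EuclideanSpace.single i 1)| ≤ 2 * B / t := by
    intro i
    have h2 : l.linear (EuclideanSpace.single i 1) * t
        = l (z + t • EuclideanSpace.single i 1) - l z := by
      rw [hadd, map_smul, smul_eq_mul]; ring
    have h3 : |l.linear (EuclideanSpace.single i 1)| * t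
        = |l.linear (EuclideanSpace.single i 1) * t| := by
      rw [abs_mul, abs_of_pos ht]
    rw [le_div_iff₀ ht, h3, h2]
    exact (abs_sub _ _).trans (by linarith [h1 i])
  have hsum : y - z = ∑ i, (y - z) i • EuclideanSpace.single i (1 : ℝ) := by
    ext j
    simp [Pi.single_apply]
  have hlin : |l.linear (y - z)| ≤ d * (‖y - z‖ * (2 * B / t)) := by
    conv_lhs => rw [hsum, map_sum]
    refine (Finset.abs_sum_le_sum_abs _ _).trans ?_
    refine (Finset.sum_le_card_nsmul _ _ (‖y - z‖ * (2 * B / t)) fun i _ => ?_).trans_eq (by simp)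
    rw [map_smul, smul_eq_mul, abs_mul]
    gcongr
    · exact PiLp.norm_apply_le (y - z) i
    · exact hdir i
  have h3 := hadd (y - z)
  rw [add_sub_cancel] at h3
  rw [h3]
  calc _ ≤ |l z| + |l.linear (y - z)| := abs_add_le _ _
    _ ≤ B + d * (‖y - z‖ * (2 * B / t)) := add_le_add h0 hlin
    _ = _ := by field_simp

/-- An interval of half-length `ρ ≥ h` contains two multiples of `h` with a prescribed distance
that is comparable with `ρ`. -/
theorem exists_grid_step {h ρ : ℝ} (hh : 0 < h) (hρ : h ≤ ρ) :
    ∃ m : ℤ, 1 ≤ m ∧ ρ ≤ 2 * (m * h) ∧ ∀ c : ℝ, ∃ n : ℤ, c - ρ ≤ n * h ∧ (n + m) * h ≤ c + ρ := by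
  have h1 : (1 : ℤ) ≤ ⌊ρ / h⌋ := Int.le_floor.2 (by rw [Int.cast_one]; exact (one_le_div hh).2 hρ)
  have h1' : (1 : ℝ) ≤ (⌊ρ / h⌋ : ℤ) := by exact_mod_cast h1
  -- The step `m` does not depend on `c`, so one step length serves all coordinate directions. The
  -- upper end holds because rounding `c - ρ` up costs at most `h ≤ ρ`.
  refine ⟨⌊ρ / h⌋, h1, ?_, fun c => ⟨⌈(c - ρ) / h⌉, ?_, ?_⟩⟩
  · have := (Int.lt_floor_add_one (ρ / h)).le
    rw [div_le_iff₀ hh] at this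
    nlinarith
  · exact (div_le_iff₀ hh).1 (Int.le_ceil _)
  · have h2 := (Int.ceil_lt_add_one ((c - ρ) / h)).le
    have h3 := Int.floor_le (ρ / h)
    have h4 : (⌈(c - ρ) / h⌉ + ⌊ρ / h⌋ : ℝ) ≤ (c + h) / h := by
      have : (c + h) / h = ((c - ρ) / h + 1) + ρ / h := by field_simp; ring
      rw [this]
      exact add_le_add h2 h3
    have := (le_div_iff₀ hh).1 h4
    linarith

theorem norm_le_sqrt_mul {d : ℕ} {x : E d} {r : ℝ} (hr : 0 ≤ r) (hx : ∀ i, |x i| ≤ r) :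
    ‖x‖ ≤ Real.sqrt d * r := by
  rw [EuclideanSpace.norm_eq]
  calc Real.sqrt (∑ i, ‖x i‖ ^ 2) ≤ Real.sqrt (d * r ^ 2) := by
        refine Real.sqrt_le_sqrt ((Finset.sum_le_card_nsmul _ _ (r ^ 2) fun i _ => ?_).trans_eq
          (by simp))
        rw [Real.norm_eq_abs]
        exact pow_le_pow_left₀ (abs_nonneg _) (hx i) 2
    _ = Real.sqrt d * r := by
        rw [Real.sqrt_mul (Nat.cast_nonneg d), Real.sqrt_sq hr]

/-- Every point of the infinite grid inside the closed cube is one of the grid nodes. -/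
theorem exists_gridPoint_eq {d N : ℕ} {R : ℝ} (hR : 0 < R) (hN : 1 ≤ N) (n : Fin d → ℤ)
    {x : E d} (hx : x ∈ closedCube d R) (h : ∀ i, x i = n i * spacing R N) :
    ∃ k : GridIndex d N, gridPoint R N k = x := by
  have hN0 : (0 : ℝ) < N := by exact_mod_cast hN
  have key : ∀ i, n i ∈ Finset.Icc (-(N : ℤ)) (N : ℤ) := by
    intro i
    have h1 := hx i
    rw [h i, spacing, mul_div_assoc', le_div_iff₀ hN0, div_le_iff₀ hN0] at h1
    rw [Finset.mem_Icc]
    constructor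
    · have : (-(N : ℝ)) ≤ n i := by nlinarith
      exact_mod_cast this
    · have : (n i : ℝ) ≤ N := by nlinarith
      exact_mod_cast this
  refine ⟨fun i => ⟨n i, key i⟩, ?_⟩
  ext i
  rw [h i]
  rfl

/-! ### Barycentric geometry of elements and stability of interpolation -/

namespace SimplicialMesh

variable {d : ℕ} (M : SimplicialMesh d)

section Element

variable {K : Finset (E d)}

/-- The vertices of an element form an affine basis. -/
def elementBasis (hK : K ∈ M.elements) : AffineBasis K ℝ (E d) :=
  ⟨fun v => v, M.indep (M.mem_elements.1 hK).1, by
    rw [(M.indep (M.mem_elements.1 hK).1).affineSpan_eq_top_iff_card_eq_finrank_add_one]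
    simpa using (M.mem_elements.1 hK).2⟩

theorem elementBasis_apply (hK : K ∈ M.elements) (v : K) : M.elementBasis hK v = v := rfl

theorem mem_convexHull_iff (hK : K ∈ M.elements) {x : E d} :
    x ∈ convexHull ℝ (K : Set (E d)) ↔ ∀ v, 0 ≤ (M.elementBasis hK).coord v x := by
  have h := (M.elementBasis hK).convexHull_eq_nonneg_coord
  have hr : Set.range (M.elementBasis hK) = (K : Set (E d)) := Subtype.range_coe
  rw [hr] at h
  rw [h]
  rfl

theorem abs_coord_sub_mul_height_le (hK : K ∈ M.elements) (v : K) (x y : E d) :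
    |(M.elementBasis hK).coord v x - (M.elementBasis hK).coord v y| * height K v ≤ ‖x - y‖ := by
  have h := abs_coord_sub_mul_infDist_le (M.elementBasis hK) v x y
  have him : M.elementBasis hK '' {v}ᶜ = (K : Set (E d)) \ {(v : E d)} := by
    ext z
    constructor
    · rintro ⟨u, hu, rfl⟩
      exact ⟨u.2, fun h => hu (Subtype.ext h)⟩
    · rintro ⟨hz, hzv⟩
      exact ⟨⟨z, hz⟩, fun h => hzv (congrArg Subtype.val h), rfl⟩
  rwa [him, M.elementBasis_apply] at h

theorem minHeight_le_height (hK : K ∈ M.elements) (v : K) : M.minHeight ≤ height K v :=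
  (Finset.inf'_le _ hK).trans (ciInf_le (Set.finite_range _).bddBelow v)

theorem dist_le_maxDiam (hK : K ∈ M.elements) {x y : E d} (hx : x ∈ convexHull ℝ (K : Set (E d)))
    (hy : y ∈ convexHull ℝ (K : Set (E d))) : dist x y ≤ M.maxDiam :=
  (Metric.dist_le_diam_of_mem (K.finite_toSet.isCompact_convexHull ℝ).isBounded hx hy).trans
    (Finset.le_sup' (fun K : Finset (E d) => Metric.diam (convexHull ℝ (K : Set (E d)))) hK)

/-- An element contains a ball of radius `a_h / (d + 1)`. -/
theorem exists_ball_subset_convexHull (hK : K ∈ M.elements) (ha : 0 < M.minHeight) :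
    ∃ c : E d, ∀ x, ‖x - c‖ ≤ M.minHeight / (d + 1) → x ∈ convexHull ℝ (K : Set (E d)) := by
  have hcard : Fintype.card K = d + 1 := by simpa using (M.mem_elements.1 hK).2
  -- At the centroid all coordinates equal `1/(d+1)`, and each changes by at most distance over
  -- height, so none turns negative within the radius.
  refine ⟨Finset.univ.centroid ℝ (M.elementBasis hK), fun x hx => ?_⟩
  rw [M.mem_convexHull_iff hK]
  intro v
  have h1 := M.abs_coord_sub_mul_height_le hK v x
    (Finset.univ.centroid ℝ (M.elementBasis hK))
  rw [(M.elementBasis hK).coord_apply_centroid (Finset.mem_univ v), Finset.card_univ, hcard] at h1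
  have h2 := M.minHeight_le_height hK v
  have h3 : |(M.elementBasis hK).coord v x - ((d + 1 : ℕ) : ℝ)⁻¹| * M.minHeight
      ≤ ((d + 1 : ℕ) : ℝ)⁻¹ * M.minHeight := by
    refine (mul_le_mul_of_nonneg_left h2 (abs_nonneg _)).trans ((h1.trans hx).trans_eq ?_)
    push_cast
    ring
  have h4 := (abs_le.1 (le_of_mul_le_mul_right h3 ha)).1
  linarith

open scoped Classical in
theorem isBarycentric_coord (hK : K ∈ M.elements) {x : E d}
    (hx : x ∈ convexHull ℝ (K : Set (E d))) :
    M.IsBarycentric (fun v => if h : v ∈ K then (M.elementBasis hK).coord ⟨v, h⟩ x else 0) x := by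
  refine ⟨K, hK, fun v => ?_, fun v hv => dif_neg hv, ?_, ?_⟩
  · dsimp only
    split_ifs with h
    · exact (M.mem_convexHull_iff hK).1 hx _
    · exact le_rfl
  · rw [← Finset.sum_coe_sort]
    simpa using (M.elementBasis hK).sum_coord_apply_eq_one x
  · rw [← Finset.sum_coe_sort K
      (fun v => (if h : v ∈ K then (M.elementBasis hK).coord ⟨v, h⟩ x else 0) • v)]
    simpa [M.elementBasis_apply hK] using (M.elementBasis hK).linear_combination_coord_eq_self x

theorem transfer_mulVec_apply (hK : K ∈ M.elements) {R : ℝ} {N : ℕ} (e : E d → ℝ)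
    {k : GridIndex d N}
    (hk : gridPoint R N k ∈ convexHull ℝ (K : Set (E d))) :
    (M.transfer R N *ᵥ fun j => e j) k
      = ∑ v : K, e v * (M.elementBasis hK).coord v (gridPoint R N k) := by
  classical
  have hb := M.isBarycentric_coord hK hk
  simp only [Matrix.mulVec, dotProduct, transfer, Matrix.of_apply]
  rw [Finset.sum_coe_sort M.nodes (fun v => M.hat v (gridPoint R N k) * e v)]
  have hsub : K ⊆ M.nodes := fun v hv => M.mem_nodes.2 ⟨K, hK, hv⟩
  rw [← Finset.sum_subset hsub fun v _ hv => by rw [M.hat_eq hb, dif_neg hv, zero_mul],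
    ← Finset.sum_coe_sort]
  refine Finset.sum_congr rfl fun v _ => ?_
  rw [M.hat_eq hb, dif_pos v.2, mul_comm]

end Element

/-- The constant of the stability estimate on one element. -/
def stabilityConst (d : ℕ) : ℝ := 1 + 4 * d * ((d + 1) * Real.sqrt d)

theorem minHeight_le_maxDiam (hd : 1 ≤ d) : M.minHeight ≤ M.maxDiam := by
  obtain ⟨K, hK⟩ := M.elements_nonempty
  have hcard := (M.mem_elements.1 hK).2
  obtain ⟨u, hu, v, hv, huv⟩ := Finset.one_lt_card.1 (by omega : 1 < K.card)
  refine (M.minHeight_le_height hK ⟨u, hu⟩).trans ?_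
  refine (Metric.infDist_le_dist_of_mem (y := v)
    (subset_affineSpan ℝ ((K : Set (E d)) \ {u}) ⟨hv, Ne.symm huv⟩)).trans ?_
  exact M.dist_le_maxDiam hK (subset_convexHull ℝ _ hu) (subset_convexHull ℝ _ hv)

open scoped Classical in
/-- On one element, nodal values are controlled by the values at the grid nodes. -/
theorem sq_le_sum_transfer_sq (hd : 1 ≤ d) {R : ℝ} (hR : 0 < R) {N : ℕ} (hN : 1 ≤ N)
    (hM : M.region ⊆ closedCube d R)
    (hh : spacing R N ≤ M.minHeight / (((d : ℝ) + 1) * Real.sqrt d))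
    {K : Finset (E d)} (hK : K ∈ M.elements) (e : E d → ℝ) {v : E d} (hv : v ∈ K) :
    e v ^ 2 ≤ (stabilityConst d * (M.maxDiam / M.minHeight)) ^ 2 *
      ∑ k with gridPoint R N k ∈ convexHull ℝ (K : Set (E d)),
        (M.transfer R N *ᵥ fun j => e j) k ^ 2 := by
  set h := spacing R N with hh_def
  set a := M.minHeight with ha_def
  set ρ := a / (((d : ℝ) + 1) * Real.sqrt d) with hρ_def
  set w := M.transfer R N *ᵥ fun j => e j with hw
  set S := ∑ k with gridPoint R N k ∈ convexHull ℝ (K : Set (E d)), w k ^ 2 with hS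
  have hd0 : (0 : ℝ) < d := by exact_mod_cast hd
  have hsd : 0 < Real.sqrt d := Real.sqrt_pos.2 hd0
  have hpos : 0 < h := div_pos hR (by exact_mod_cast hN)
  have hρ : 0 < ρ := hpos.trans_le hh
  have hden : 0 < ((d : ℝ) + 1) * Real.sqrt d := by positivity
  have ha : 0 < a := by
    have := mul_pos hρ hden
    rwa [hρ_def, div_mul_cancel₀ _ hden.ne'] at this
  have hda : a ≤ M.maxDiam := M.minHeight_le_maxDiam hd
  obtain ⟨c, hc⟩ := M.exists_ball_subset_convexHull hK ha
  obtain ⟨m, hm1, hm2, hm⟩ := exists_grid_step hpos hh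
  choose n hn1 hn2 using fun i => hm (c i)
  have hm0 : (1 : ℝ) ≤ m := by exact_mod_cast hm1
  -- A cube of half-side `ρ` fits into the inscribed ball, because `√d ρ = a/(d+1)`.
  have hbox : ∀ x : E d, (∀ i, x i = n i * h ∨ x i = (n i + m) * h) →
      x ∈ convexHull ℝ (K : Set (E d)) := by
    intro x hx
    refine hc x ((norm_le_sqrt_mul hρ.le fun i => ?_).trans_eq ?_)
    · rw [PiLp.sub_apply, abs_le]
      have h1 := hn1 i
      have h2 := hn2 i
      have h3 : 0 ≤ m * h := by positivity
      rcases hx i with h4 | h4 <;> rw [h4] <;> constructor <;> linarith [add_mul (n i : ℝ) m h]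
    · rw [hρ_def, ← ha_def]
      field_simp
  -- The interpolant on `K`, continued affinely to the whole space; it agrees with `w` at the grid
  -- nodes in `K`.
  set l : E d →ᵃ[ℝ] ℝ := ∑ u : K, e u • (M.elementBasis hK).coord u with hl
  have hlapp : ∀ x, l x = ∑ u : K, e u * (M.elementBasis hK).coord u x := by
    intro x
    rw [hl, sum_smul_affineMap_apply]
  have hsmall : ∀ x : E d, (∀ i, x i = n i * h ∨ x i = (n i + m) * h) → |l x| ≤ Real.sqrt S := by
    intro x hx
    have hxK := hbox x hx
    have hex : ∀ i, ∃ n' : ℤ, x i = n' * h := fun i => by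
      rcases hx i with h4 | h4
      · exact ⟨n i, h4⟩
      · exact ⟨n i + m, by rw [h4]; push_cast; rfl⟩
    choose n' hn' using hex
    obtain ⟨k, hk⟩ := exists_gridPoint_eq hR hN n'
      (hM (Set.mem_biUnion (show K ∈ (M.elements : Set _) from hK) hxK)) hn'
    have hkK : gridPoint R N k ∈ convexHull ℝ (K : Set (E d)) := hk ▸ hxK
    have hwk : l x = w k := by
      rw [hlapp, hw, M.transfer_mulVec_apply hK e hkK, hk]
    rw [hwk]
    refine Real.abs_le_sqrt ?_
    exact Finset.single_le_sum (f := fun k => w k ^ 2) (fun k _ => sq_nonneg _)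
      (Finset.mem_filter.2 ⟨Finset.mem_univ k, hkK⟩)
  set z : E d := WithLp.toLp 2 fun i => n i * h with hz
  have hz0 : ∀ i, z i = n i * h ∨ z i = (n i + m) * h := fun i => Or.inl rfl
  have hmain := abs_affineMap_le l (z := z) (t := m * h) (B := Real.sqrt S) (by positivity)
    (hsmall z hz0) (fun i => hsmall _ fun j => by
      by_cases hij : j = i
      · right
        subst hij
        simp [hz, add_mul]
      · left
        simp [hz, hij]) v
  have hlv : l v = e v := by
    rw [hlapp, Finset.sum_eq_single ⟨v, hv⟩]
    · rw [show (M.elementBasis hK).coord ⟨v, hv⟩ v = 1 from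
        (M.elementBasis hK).coord_apply_eq ⟨v, hv⟩, mul_one]
    · intro u _ hu
      rw [show (M.elementBasis hK).coord u v = 0 from
        (M.elementBasis hK).coord_apply_ne (j := ⟨v, hv⟩) hu, mul_zero]
    · exact fun h => absurd (Finset.mem_univ _) h
  have hdist : ‖v - z‖ ≤ M.maxDiam := by
    rw [← dist_eq_norm]
    exact M.dist_le_maxDiam hK (subset_convexHull ℝ _ hv) (hbox z hz0)
  -- The bound `ρ ≤ 2mh` contributes a factor 2, which explains the 4 in `stabilityConst`; the
  -- leading 1 is absorbed by `a ≤ M.maxDiam`.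
  have hfac : 1 + 2 * d * (‖v - z‖ / (m * h)) ≤ stabilityConst d * (M.maxDiam / a) := by
    have h1 : 1 ≤ M.maxDiam / a := (one_le_div ha).2 hda
    have h2 : ‖v - z‖ / (m * h) ≤ 2 * (((d : ℝ) + 1) * Real.sqrt d) * (M.maxDiam / a) := by
      calc ‖v - z‖ / (m * h) ≤ M.maxDiam / (ρ / 2) := by
            gcongr
            · exact ha.le.trans hda
            · linarith
        _ = _ := by rw [hρ_def]; field_simp
    calc 1 + 2 * d * (‖v - z‖ / (m * h))
        ≤ M.maxDiam / a + 2 * d * (2 * (((d : ℝ) + 1) * Real.sqrt d) * (M.maxDiam / a)) := by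
          gcongr
      _ = _ := by rw [stabilityConst]; ring
  rw [hlv] at hmain
  have hS0 : 0 ≤ S := Finset.sum_nonneg fun k _ => sq_nonneg _
  have hfinal := hmain.trans (mul_le_mul_of_nonneg_right hfac (Real.sqrt_nonneg S))
  calc e v ^ 2 = |e v| ^ 2 := (sq_abs _).symm
    _ ≤ (stabilityConst d * (M.maxDiam / a) * Real.sqrt S) ^ 2 := by gcongr
    _ = _ := by rw [mul_pow, Real.sq_sqrt hS0]

open scoped Classical in
/-- A point lies in at most `N_val` closed elements. -/
theorem card_elements_containing_le (x : E d) :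
    (M.elements.filter fun K : Finset (E d) => x ∈ convexHull ℝ (K : Set (E d))).card
      ≤ M.valence := by
  rcases (M.elements.filter fun K : Finset (E d) =>
      x ∈ convexHull ℝ (K : Set (E d))).eq_empty_or_nonempty with
    h | ⟨K, hKx⟩
  · simp [h]
  obtain ⟨hK, hx⟩ := Finset.mem_filter.1 hKx
  have hb := M.isBarycentric_coord hK hx
  -- Barycentric weights of `x` do not depend on the element, so a vertex with nonzero weight
  -- belongs to every element containing `x`.
  obtain ⟨v, hv⟩ : ∃ v : K, (M.elementBasis hK).coord v x ≠ 0 := by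
    by_contra! hc
    have := (M.elementBasis hK).sum_coord_apply_eq_one x
    simp [hc] at this
  have hle : (M.elements.filter fun L => (v : E d) ∈ L).card ≤ M.valence :=
    Finset.le_sup (f := fun v => (M.elements.filter fun K => v ∈ K).card)
      (M.mem_nodes.2 ⟨K, hK, v.2⟩)
  refine (Finset.card_le_card fun L hLx => ?_).trans hle
  obtain ⟨hL, hxL⟩ := Finset.mem_filter.1 hLx
  refine Finset.mem_filter.2 ⟨hL, ?_⟩
  by_contra hvL
  have := congrFun (M.isBarycentric_unique hb (M.isBarycentric_coord hL hxL)) v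
  simp only [dif_pos v.2, dif_neg hvL] at this
  exact hv this

/-- The transfer matrix is bounded below. -/
theorem dotProduct_le_transfer (hd : 1 ≤ d) {R : ℝ} (hR : 0 < R) {N : ℕ} (hN : 1 ≤ N)
    (hM : M.region ⊆ closedCube d R)
    (hh : spacing R N ≤ M.minHeight / (((d : ℝ) + 1) * Real.sqrt d)) (e : M.nodes → ℝ) :
    e ⬝ᵥ e ≤ (d + 1) * M.valence * (stabilityConst d * (M.maxDiam / M.minHeight)) ^ 2 *
      ((M.transfer R N *ᵥ e) ⬝ᵥ (M.transfer R N *ᵥ e)) := by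
  classical
  set e' : E d → ℝ := fun v => if h : v ∈ M.nodes then e ⟨v, h⟩ else 0 with he'
  have hee : e = fun j : M.nodes => e' j := by
    funext j
    simp [he']
  set w := M.transfer R N *ᵥ e with hw
  set c := (stabilityConst d * (M.maxDiam / M.minHeight)) ^ 2 with hc
  have hc0 : 0 ≤ c := sq_nonneg _
  have hel : ∀ K ∈ M.elements, ∀ v ∈ K, e' v ^ 2 ≤ c *
      ∑ k with gridPoint R N k ∈ convexHull ℝ (K : Set (E d)), w k ^ 2 := by
    intro K hK v hv
    have := M.sq_le_sum_transfer_sq hd hR hN hM hh hK e' hv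
    rwa [← hee, ← hw] at this
  calc e ⬝ᵥ e = ∑ v ∈ M.nodes, e' v ^ 2 := by
        rw [hee, dotProduct, Finset.sum_coe_sort M.nodes (fun v => e' v * e' v)]
        exact Finset.sum_congr rfl fun v _ => (sq _).symm
    _ ≤ ∑ K ∈ M.elements, ∑ v ∈ K, e' v ^ 2 :=
        sum_biUnion_le (f := fun v => e' v ^ 2) (fun v => sq_nonneg _) M.elements
    _ ≤ ∑ K ∈ M.elements, (d + 1) * (c *
          ∑ k with gridPoint R N k ∈ convexHull ℝ (K : Set (E d)), w k ^ 2) := by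
        refine Finset.sum_le_sum fun K hK => ?_
        refine (Finset.sum_le_card_nsmul _ _ _ (hel K hK)).trans_eq ?_
        rw [(M.mem_elements.1 hK).2, nsmul_eq_mul]
        push_cast
        rfl
    -- Exchanging the sums counts each grid node once per closed element containing it.
    _ = (d + 1) * c * ∑ k, (M.elements.filter fun K : Finset (E d) =>
          gridPoint R N k ∈ convexHull ℝ (K : Set (E d))).card * w k ^ 2 := by
        simp only [← Finset.mul_sum, Finset.sum_filter, mul_assoc]
        rw [Finset.sum_comm]
        congr 2
        refine Finset.sum_congr rfl fun k _ => ?_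
        rw [← Finset.sum_filter, Finset.sum_const, nsmul_eq_mul]
    _ ≤ (d + 1) * c * ∑ k, M.valence * w k ^ 2 := by
        gcongr with k
        exact M.card_elements_containing_le _
    _ = _ := by
        rw [← Finset.mul_sum]
        simp only [dotProduct, sq]
        ring

end SimplicialMesh

/-! ### The error estimate -/

namespace SimplicialMesh

variable {d : ℕ} (M : SimplicialMesh d)

theorem isBarycentric_nonneg {w : E d → ℝ} {x : E d} (h : M.IsBarycentric w x) (v : E d) :
    0 ≤ w v := by
  obtain ⟨K, -, h0, -⟩ := h
  exact h0 v

theorem hat_nonneg (v x : E d) : 0 ≤ M.hat v x := by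
  by_cases h : ∃ w, M.IsBarycentric w x
  · obtain ⟨w, hw⟩ := h
    rw [M.hat_eq hw]
    exact M.isBarycentric_nonneg hw v
  · rw [hat, dif_neg h]

/-- A vanishing column would put a unit vector in the kernel of the transfer matrix, against
stability. This makes `D_h` invertible. -/
theorem sum_transfer_pos (hd : 1 ≤ d) {R : ℝ} (hR : 0 < R) {N : ℕ} (hN : 1 ≤ N)
    (hM : M.region ⊆ closedCube d R)
    (hh : spacing R N ≤ M.minHeight / (((d : ℝ) + 1) * Real.sqrt d)) (j : M.nodes) :
    0 < ∑ k, M.transfer R N k j := by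
  classical
  have hnn : ∀ k, 0 ≤ M.transfer R N k j := fun k => M.hat_nonneg _ _
  refine (Finset.sum_nonneg fun k _ => hnn k).lt_of_ne' fun h0 => ?_
  have hz := (Finset.sum_eq_zero_iff_of_nonneg fun k _ => hnn k).1 h0
  have h := M.dotProduct_le_transfer hd hR hN hM hh (Pi.single j 1)
  have hw : M.transfer R N *ᵥ Pi.single j 1 = 0 := by
    funext k
    rw [Matrix.mulVec_single_one]
    exact hz k (Finset.mem_univ k)
  rw [hw] at h
  simp at h
  linarith

/-- An element without grid nodes would make the local stability estimate for the constant 1 read `1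
≤ 0`. -/
theorem one_le_maxGridNodes (hd : 1 ≤ d) {R : ℝ} (hR : 0 < R) {N : ℕ} (hN : 1 ≤ N)
    (hM : M.region ⊆ closedCube d R)
    (hh : spacing R N ≤ M.minHeight / (((d : ℝ) + 1) * Real.sqrt d)) :
    1 ≤ M.maxGridNodes R N := by
  classical
  obtain ⟨K, hK⟩ := M.elements_nonempty
  have hcard := (M.mem_elements.1 hK).2
  obtain ⟨v, hv⟩ := Finset.card_pos.1 (by omega : 0 < K.card)
  have h := M.sq_le_sum_transfer_sq hd hR hN hM hh hK (fun _ => 1) hv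
  refine le_trans (Nat.one_le_iff_ne_zero.2 fun h0 => ?_)
    (Finset.le_sup (f := fun K : Finset (E d) => (Finset.univ.filter fun k : GridIndex d N =>
      gridPoint R N k ∈ convexHull ℝ (K : Set (E d))).card) hK)
  rw [Finset.card_eq_zero] at h0
  rw [h0] at h
  norm_num at h

theorem inv_columnSums_mul_mulVec {R : ℝ} {N : ℕ}
    (hpos : ∀ j, 0 < ∑ k, M.transfer R N k j) {ι : Type*} [Fintype ι]
    (B : Matrix M.nodes ι ℝ) (x : ι → ℝ) (j : M.nodes) :
    (((M.columnSums R N)⁻¹ * B) *ᵥ x) j = (∑ k, M.transfer R N k j)⁻¹ * (B *ᵥ x) j := by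
  classical
  have hinv : (M.columnSums R N)⁻¹ = Matrix.diagonal fun j => (∑ k, M.transfer R N k j)⁻¹ := by
    refine Matrix.inv_eq_left_inv ?_
    rw [columnSums, Matrix.diagonal_mul_diagonal, ← Matrix.diagonal_one]
    congr 1
    funext j
    exact inv_mul_cancel₀ (hpos j).ne'
  rw [hinv, ← Matrix.mulVec_mulVec, Matrix.mulVec_diagonal]

end SimplicialMesh

/-- Testing the scheme with the error. -/
theorem energy_eq_truncationError {d : ℕ} (M : SimplicialMesh d) (Ω : Set (E d)) {s R : ℝ} {N : ℕ}
    (hpos : ∀ j, 0 < ∑ k, M.transfer R N k j) (f ue : E d → ℝ) {uh : M.nodes → ℝ}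
    (hu : SolvesFullScheme M Ω s R N f uh ∨ SolvesInteriorScheme M Ω s R N f uh)
    {w : GridIndex d N → ℝ} (hw : w = M.transfer R N *ᵥ (uh - nodalValues M Ω ue)) :
    1 / spacing R N ^ (2 * s) * (w ⬝ᵥ (matrixFD d N s *ᵥ w))
      = w ⬝ᵥ truncationError M Ω s R N f ue := by
  set c := 1 / spacing R N ^ (2 * s) with hc
  set T := M.transfer R N with hT
  set A := matrixFD d N s with hA
  set e := uh - nodalValues M Ω ue with he
  have heq : ∀ j, schemeLHS M s R N uh j = schemeRHS M Ω f R N j →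
      (Tᵀ *ᵥ (c • (A *ᵥ (T *ᵥ uh)) - gridValues Ω f R N)) j = 0 := by
    intro j hj
    rw [schemeLHS, schemeRHS, SimplicialMesh.stiffness, Matrix.mul_assoc, Matrix.mul_assoc,
      Pi.smul_apply, M.inv_columnSums_mul_mulVec hpos, M.inv_columnSums_mul_mulVec hpos,
      smul_eq_mul, mul_left_comm] at hj
    have h1 := mul_left_cancel₀ (inv_ne_zero (hpos j).ne') hj
    rw [Matrix.mulVec_sub, Pi.sub_apply, Matrix.mulVec_smul, Pi.smul_apply, smul_eq_mul,
      sub_eq_zero, ← h1, Matrix.mulVec_mulVec, Matrix.mulVec_mulVec, Matrix.mul_assoc]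
  -- For the interior scheme, equations are missing exactly at vertices outside `Ω`, where both
  -- vectors, hence the error, vanish.
  have hzero : ∀ j, e j * (Tᵀ *ᵥ (c • (A *ᵥ (T *ᵥ uh)) - gridValues Ω f R N)) j = 0 := by
    intro j
    rcases hu with hu | hu
    · rw [heq j (congrFun hu j), mul_zero]
    · by_cases hj : (j : E d) ∈ Ω
      · rw [heq j (hu.2 j hj), mul_zero]
      · rw [he, Pi.sub_apply, hu.1 j hj, nodalValues, if_neg hj, sub_zero, zero_mul]
  have hsum : w ⬝ᵥ (c • (A *ᵥ (T *ᵥ uh)) - gridValues Ω f R N) = 0 := by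
    rw [hw, ← Matrix.vecMul_transpose, ← Matrix.dotProduct_mulVec]
    exact Finset.sum_eq_zero fun j _ => hzero j
  have hsplit : T *ᵥ uh = w + T *ᵥ nodalValues M Ω ue := by
    rw [hw, he, Matrix.mulVec_sub, sub_add_cancel]
  rw [hsplit, Matrix.mulVec_add, smul_add, dotProduct_sub, dotProduct_add, dotProduct_smul,
    smul_eq_mul] at hsum
  rw [truncationError, dotProduct_sub]
  linarith

/-- Expanding `|t - c w|² ≥ 0` replaces Cauchy–Schwarz and avoids dividing by the norm of `w`. -/
theorem sq_mul_dotProduct_le {ι : Type*} [Fintype ι] {c : ℝ} (hc : 0 ≤ c) {w t : ι → ℝ}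
    (h : c * (w ⬝ᵥ w) ≤ w ⬝ᵥ t) : c ^ 2 * (w ⬝ᵥ w) ≤ t ⬝ᵥ t := by
  have h1 : 0 ≤ (t - c • w) ⬝ᵥ (t - c • w) := Finset.sum_nonneg fun i _ => mul_self_nonneg _
  have h2 : (t - c • w) ⬝ᵥ (t - c • w) = t ⬝ᵥ t - 2 * c * (w ⬝ᵥ t) + c ^ 2 * (w ⬝ᵥ w) := by
    simp only [sub_dotProduct, dotProduct_sub, smul_dotProduct, dotProduct_smul, smul_eq_mul,
      dotProduct_comm t w]
    ring
  nlinarith [mul_le_mul_of_nonneg_left h hc]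

end GoFD

end

/-! ### Assembly of the error estimate -/

theorem mainTheorem4 (d : ℕ) (hd : 1 ≤ d) (s : ℝ) (hs0 : 0 < s) (hs1 : s < 1)
    (R : ℝ) (hR : 0 < R) :
    ∃ C : ℝ, 0 < C ∧
      ∀ (Ω : Set (GoFD.E d)), IsOpen Ω → Ω ⊆ GoFD.openCube d R →
      ∀ (M : GoFD.SimplicialMesh d), M.region ⊆ GoFD.closedCube d R →
      ∀ (N : ℕ), 1 ≤ N →
        GoFD.spacing R N ≤ M.minHeight / (((d : ℝ) + 1) * Real.sqrt d) →
      ∀ (f ue : GoFD.E d → ℝ), GoFD.IsExactSolution s Ω f ue →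
      ∀ (uh : M.nodes → ℝ),
        (GoFD.SolvesFullScheme M Ω s R N f uh ∨ GoFD.SolvesInteriorScheme M Ω s R N f uh) →
      ∀ (eh : M.nodes → ℝ), eh = uh - GoFD.nodalValues M Ω ue →
        eh ⬝ᵥ eh ≤ C * (M.valence : ℝ) * (M.maxGridNodes R N : ℝ) *
          (M.maxDiam / M.minHeight) ^ (4 * d) *
          (GoFD.truncationError M Ω s R N f ue ⬝ᵥ GoFD.truncationError M Ω s R N f ue) := by
  -- The coercivity constant after scaling: `1/(3N) = h_FD/(3R)`, so `h_FD^{-2s}` removes all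
  -- dependence on `N`.
  set κ : ℝ := (1 / (3 * R)) ^ (2 * s) / 2 with hκ
  have hκ0 : 0 < κ := by positivity
  have hst : 0 < GoFD.SimplicialMesh.stabilityConst d := by
    unfold GoFD.SimplicialMesh.stabilityConst
    positivity
  refine ⟨(d + 1) * GoFD.SimplicialMesh.stabilityConst d ^ 2 / κ ^ 2, by positivity, ?_⟩
  intro Ω _ _ M hM N hN hh f ue _ uh hu eh he
  have hpos := M.sum_transfer_pos hd hR hN hM hh
  set w := M.transfer R N *ᵥ eh with hw
  set τ := GoFD.truncationError M Ω s R N f ue with hτ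
  have hen := GoFD.energy_eq_truncationError M Ω hpos f ue hu (w := w) (by rw [hw, he])
  have hN0 : (0 : ℝ) < N := by exact_mod_cast hN
  have hsp : 0 < GoFD.spacing R N := div_pos hR hN0
  have hww : 0 ≤ w ⬝ᵥ w := Finset.sum_nonneg fun i _ => mul_self_nonneg _
  have hττ : 0 ≤ τ ⬝ᵥ τ := Finset.sum_nonneg fun i _ => mul_self_nonneg _
  have hκw : κ * (w ⬝ᵥ w) ≤ w ⬝ᵥ τ := by
    rw [← hen]
    refine le_trans (le_of_eq ?_) (mul_le_mul_of_nonneg_left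
      (GoFD.matrixFD_coercive hd hN hs0.le w) (by positivity))
    have h1 : (1 : ℝ) / (3 * N) = 1 / (3 * R) * GoFD.spacing R N := by
      rw [GoFD.spacing]
      field_simp
    rw [h1, Real.mul_rpow (by positivity) hsp.le, hκ]
    have h2 : GoFD.spacing R N ^ (2 * s) ≠ 0 := (Real.rpow_pos_of_pos hsp _).ne'
    field_simp
  have hwτ := GoFD.sq_mul_dotProduct_le hκ0.le hκw
  have hstab := M.dotProduct_le_transfer hd hR hN hM hh eh
  rw [← hw] at hstab
  have ha : 0 < M.minHeight := by
    by_contra! hc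
    exact (hsp.trans_le hh).not_ge (div_nonpos_of_nonpos_of_nonneg hc (by positivity))
  have hratio : 1 ≤ M.maxDiam / M.minHeight := (one_le_div ha).2 (M.minHeight_le_maxDiam hd)
  have hgrid : (1 : ℝ) ≤ M.maxGridNodes R N := by
    exact_mod_cast M.one_le_maxGridNodes hd hR hN hM hh
  have hpow : (M.maxDiam / M.minHeight) ^ 2 ≤ (M.maxDiam / M.minHeight) ^ (4 * d) :=
    pow_le_pow_right₀ hratio (by omega)
  calc eh ⬝ᵥ eh ≤ (d + 1) * M.valence *
        (GoFD.SimplicialMesh.stabilityConst d * (M.maxDiam / M.minHeight)) ^ 2 * (w ⬝ᵥ w) := hstab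
    -- The explicit factor `1` holds the place of `N_FD^h` for the termwise comparison that follows.
    _ = (d + 1) * GoFD.SimplicialMesh.stabilityConst d ^ 2 / κ ^ 2 * M.valence * 1 *
        (M.maxDiam / M.minHeight) ^ 2 * (κ ^ 2 * (w ⬝ᵥ w)) := by
      field_simp
    _ ≤ _ := by gcongr
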